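/- Setting. Let $\varphi:\mathbb R\to\mathbb R$ be an Orlicz N-function (continuous, even, convex, increasing on $(0,\infty)$, $\varphi(0)=0$, $\varphi(x)/x\to0$ as $x\to0$, $\varphi(x)/x\to\infty$ as $x\to\infty$) for which $\lim_{x\to0}\varphi(x)/x^2$ exists and lies in $(0,+\infty]$. Let $\varphi^{(-1)}$ be the inverse of $\varphi|_{[0,\infty)}$ and $\varphi^*(x)=\sup_{y\in\mathbb R}(xy-\varphi(y))$. On a probability space $(\Omega,\mathcal B,\mathbf P)$, a zero mean random variable $\xi$ is $\varphi$-sub-Gaussian if for some $a\ge0$ one has $\mathbf E e^{\lambda\xi}\le e^{\varphi(a\lambda)}$ for all $\lambda\in\mathbb R$, and then $\tau_\varphi(\xi)=\sup_{\lambda\ne0}\varphi^{(-1)}(\ln\mathbf E e^{\lambda\xi})/|\lambda|$. Let $\mathbf T$ be a non-empty set and $X(t)$, $t\in\mathbf T$, a process all of whose values $X(t)$ are $\varphi$-sub-Gaussian, with $\varepsilon_0=\sup_{t\in\mathbf T}\tau_\varphi(X(t))$ and $0<\varepsilon_0<\infty$. Equip $\mathbf T$ with the pseudometric $\rho_X(t,s)=\tau_\varphi(X(t)-X(s))$.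 Assume that $(\mathbf T,\rho_X)$ is separable and that $X$ is a separable process, that is, there are a countable dense $S\subset\mathbf T$ and a $\mathbf P$-null set off which, for every open $U\subset\mathbf T$ and every closed (possibly infinite) interval $D\subset\mathbb R$, $X(s)\in D$ for all $s\in U\cap S$ implies $X(t)\in D$ for all $t\in U$. For $v>0$ let $N(v)\in\mathbb N\cup\{\infty\}$ be the smallest number of closed $\rho_X$-balls of radius $v$ that cover $\mathbf T$ (the smallest cardinality of a $v$-net). Theorem. Let $r:[1,\infty)\to[0,\infty)$ be strictly increasing, with inverse $r^{(-1)}$, such that $x\mapsto r(e^x)$ is convex on $[0,\infty)$ and, with $r(\infty)=\infty$, $I_r(v)=\int_0^v r(N(u))\,du<\infty$ for all $v>0$. Then $\sup_{t\in\mathbf T}|X(t)|$ is measurable up to a $\mathbf P$-null set; for all $\lambda>0$ and $0<\theta<1$, $$\mathbf E\exp\Big\{\lambda\sup_{t\in\mathbf T}|X(t)|\Big\}\le 2\exp\Big\{\varphi\Big(\frac{\lambda\varepsilon_0}{1-\theta}\Big)\Big\}\,r^{(-1)}\Big(\frac{I_r(\theta\varepsilon_0)}{\theta\varepsilon_0}\Big);$$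 and for all $u\ge0$ and $0<\theta<1$, $$\mathbf P\Big\{\sup_{t\in\mathbf T}|X(t)|\ge u\Big\}\le 2\exp\Big\{-\varphi^*\Big(\frac{u(1-\theta)}{\varepsilon_0}\Big)\Big\}\,r^{(-1)}\Big(\frac{I_r(\theta\varepsilon_0)}{\theta\varepsilon_0}\Big).$$ -/

import Mathlib

open MeasureTheory ProbabilityTheory Filter Topology Set
open scoped ENNReal

noncomputable section

namespace PhiSub

/-- Orlicz N-functions: continuous, even, convex, increasing on the positive half-line, vanishing
at zero, with `φ x / x → 0` as `x → 0` and `φ x / x → ∞` as `x → ∞`. -/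
structure IsOrliczN (φ : ℝ → ℝ) : Prop where
  continuous : Continuous φ
  even : ∀ x, φ (-x) = φ x
  convex : ConvexOn ℝ univ φ
  strictMono : StrictMonoOn φ (Ioi 0)
  map_zero : φ 0 = 0
  tendsto_zero : Tendsto (fun x => φ x / x) (𝓝[≠] 0) (𝓝 0)
  tendsto_atTop : Tendsto (fun x => φ x / x) atTop atTop

/-- Condition Q: `φ x / x ^ 2` has a limit `C > 0` at zero, where `C = +∞` is allowed. -/
def ConditionQ (φ : ℝ → ℝ) : Prop :=
  ∃ C : EReal, 0 < C ∧ Tendsto (fun x : ℝ => ((φ x / x ^ 2 : ℝ) : EReal)) (𝓝[≠] 0) (𝓝 C)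

/-- The Young-Fenchel transform `φ* x = sup_y (x y - φ y)`. -/
def youngFenchel (φ : ℝ → ℝ) (x : ℝ) : ℝ := ⨆ y : ℝ, (x * y - φ y)

/-- The inverse function of `φ` restricted to `[0, ∞)`. -/
def phiInv (φ : ℝ → ℝ) : ℝ → ℝ := Function.invFunOn φ (Ici 0)

variable {Ω : Type*} [MeasurableSpace Ω]

/-- The space of `φ`-sub-Gaussian random variables: zero mean variables `ξ` such that for some
`a ≥ 0` one has `E exp (l ξ) ≤ exp (φ (a l))`, the expectation being finite, for all real `l`. -/
structure IsSub (φ : ℝ → ℝ) (P : Measure Ω) (ξ : Ω → ℝ) : Prop where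
  aemeasurable : AEMeasurable ξ P
  integrable : Integrable ξ P
  zero_mean : ∫ ω, ξ ω ∂P = 0
  exists_bound : ∃ a : ℝ, 0 ≤ a ∧ ∀ l : ℝ,
    Integrable (fun ω => Real.exp (l * ξ ω)) P ∧
      ∫ ω, Real.exp (l * ξ ω) ∂P ≤ Real.exp (φ (a * l))

/-- The norm `τ_φ ξ = sup_{l ≠ 0} φ⁻¹ (ln E exp (l ξ)) / |l|`. -/
def tau (φ : ℝ → ℝ) (P : Measure Ω) (ξ : Ω → ℝ) : ℝ :=
  ⨆ l : {l : ℝ // l ≠ 0},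
    phiInv φ (Real.log (∫ ω, Real.exp ((l : ℝ) * ξ ω) ∂P)) / |(l : ℝ)|

variable {T : Type*}

/-- The pseudometric on the parameter set generated by the process. -/
def rho (φ : ℝ → ℝ) (P : Measure Ω) (X : T → Ω → ℝ) (t s : T) : ℝ :=
  tau φ P (fun ω => X t ω - X s ω)

/-- `ε₀ = sup_t τ_φ (X t)`. -/
def epsZero (φ : ℝ → ℝ) (P : Measure Ω) (X : T → Ω → ℝ) : ℝ := ⨆ t, tau φ P (X t)

/-- `S` is dense in `T` with respect to the pseudometric `ρ`. -/
def IsRhoDense (ρ : T → T → ℝ) (S : Set T) : Prop :=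
  ∀ t, ∀ ε > 0, ∃ s ∈ S, ρ t s < ε

/-- `U` is open in the topology of the pseudometric `ρ`. -/
def IsRhoOpen (ρ : T → T → ℝ) (U : Set T) : Prop :=
  ∀ t ∈ U, ∃ ε > 0, ∀ s, ρ t s < ε → s ∈ U

/-- The pseudometric space `(T, ρ)` is separable. -/
def IsRhoSeparable (ρ : T → T → ℝ) : Prop :=
  ∃ S : Set T, S.Countable ∧ IsRhoDense ρ S

/-- Separability of a process in the sense of Doob over the pseudometric space `(T, ρ)`: there are
a countable dense set `S` and a null set off which, for every open `U` and every closed (possibly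
infinite) interval `D`, `X s ∈ D` for all `s ∈ U ∩ S` implies `X t ∈ D` for all `t ∈ U`. -/
def IsSeparableProcess (ρ : T → T → ℝ) (P : Measure Ω) (X : T → Ω → ℝ) : Prop :=
  ∃ S : Set T, S.Countable ∧ IsRhoDense ρ S ∧
    ∀ᵐ ω ∂P, ∀ U : Set T, IsRhoOpen ρ U → ∀ D : Set ℝ, IsClosed D → D.OrdConnected →
      (∀ s ∈ U ∩ S, X s ω ∈ D) → ∀ t ∈ U, X t ω ∈ D

/-- Metric massiveness `N v`: the smallest number of points of a `v`-net of `T`, that is, of closed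
balls of radius `v` that cover `T`; it is `⊤` if there is no finite one. -/
def massiveness (ρ : T → T → ℝ) (v : ℝ) : ℕ∞ :=
  ⨅ (A : Finset T) (_ : ∀ t, ∃ s ∈ A, ρ s t ≤ v), (A.card : ℕ∞)

/-- The value of `r` at a possibly infinite cardinality, with `r (+∞) = +∞`. -/
def extend (r : ℝ → ℝ) : ℕ∞ → ℝ≥0∞
  | ⊤ => ⊤
  | (n : ℕ) => ENNReal.ofReal (r n)

/-- `I_r v = ∫_0^v r (N u) du`, with values in `[0, ∞]`. -/
def entropyIntegral (r : ℝ → ℝ) (ρ : T → T → ℝ) (v : ℝ) : ℝ≥0∞ :=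
  ∫⁻ u in Ioc 0 v, extend r (massiveness ρ u)

/-- The inverse function of `r` restricted to `[1, ∞)`. -/
def rInv (r : ℝ → ℝ) : ℝ → ℝ := Function.invFunOn r (Ici 1)

/-- `sup_t |X t|` as a function on the probability space with values in `[0, ∞]`. -/
def supAbs (X : T → Ω → ℝ) (ω : Ω) : EReal := ⨆ t, ((|X t ω| : ℝ) : EReal)

end PhiSub

end

namespace PhiSub

/-! ### Orlicz N-functions and their inverses -/

section OrliczFunction

variable {φ : ℝ → ℝ}

/-! The proof is chaining through Hölder's inequality. Put `v = θ ε₀` and take minimal nets `B k` of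
radius `θ ^ k v`. A point `t` of a finite set `F` is joined to `B 0` through `B (m-1), …, B 1`, so
`|X t|` is at most the sum of the absolute increments along the chain, and the level `k` increment
has `τ_φ` at most `θ ^ k ε₀`. Hölder with weights `w k = (1 - θ) θ ^ k`, and `θ ^ m` for the last
level `F`, multiplies the level `k` increment by `λ / w k`. The weights decay at the same rate as
the increments, so every level obeys the same bound `2 exp (φ (λ ε₀ / (1 - θ)))` per point. As the
weights sum to one, only one copy survives, times the product of the `N (θ ^ k v) ^ w k` and `(card
F) ^ (θ ^ m)` (`lintegral_iSup_exp_le_prod`).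

Jensen's inequality for `r ∘ exp` bounds the geometric mean of the massivenesses by `r⁻¹` of the
arithmetic mean of their `r`-values (`prod_rpow_le_rInv`). That mean is a lower Riemann sum of `I_r
v / v`, because `w k v` is the length of `(θ ^ (k+1) v, θ ^ k v]` (`sum_le_entropyIntegral`).

Letting `m → ∞` removes `card F`; separability and monotone convergence replace `F` by `T`. The tail
bound is Markov's inequality optimized over `λ`. -/

theorem IsOrliczN.nonneg (hφ : IsOrliczN φ) (x : ℝ) : 0 ≤ φ x := by
  have h := hφ.convex.2 (mem_univ x) (mem_univ (-x)) (by norm_num : (0 : ℝ) ≤ 1 / 2)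
    (by norm_num : (0 : ℝ) ≤ 1 / 2) (by norm_num)
  simp only [smul_eq_mul, hφ.even] at h
  rw [show (1 / 2 : ℝ) * x + 1 / 2 * -x = 0 by ring, hφ.map_zero] at h
  linarith

theorem IsOrliczN.strictMonoOn_Ici (hφ : IsOrliczN φ) : StrictMonoOn φ (Ici 0) := by
  intro x hx y hy hxy
  rcases eq_or_lt_of_le (mem_Ici.1 hx) with rfl | hx
  · rw [hφ.map_zero]
    exact (hφ.nonneg (y / 2)).trans_lt
      (hφ.strictMono (mem_Ioi.2 (by linarith)) (mem_Ioi.2 hxy) (by linarith))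
  · exact hφ.strictMono hx (hx.trans hxy) hxy

theorem IsOrliczN.map_abs (hφ : IsOrliczN φ) (x : ℝ) : φ |x| = φ x := by
  rcases abs_choice x with h | h <;> rw [h]
  exact hφ.even x

theorem IsOrliczN.map_le_map (hφ : IsOrliczN φ) {x y : ℝ} (h : |x| ≤ |y|) : φ x ≤ φ y := by
  rw [← hφ.map_abs x, ← hφ.map_abs y]
  exact hφ.strictMonoOn_Ici.monotoneOn (abs_nonneg x) (abs_nonneg y) h

theorem IsOrliczN.exists_map_eq (hφ : IsOrliczN φ) {y : ℝ} (hy : 0 ≤ y) :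
    ∃ x ∈ Ici (0 : ℝ), φ x = y := by
  obtain ⟨x, hx1, hx2⟩ := ((hφ.tendsto_atTop.eventually_ge_atTop 1).and
    (eventually_ge_atTop (max y 1))).exists
  have hx0 : 0 < x := one_pos.trans_le ((le_max_right y 1).trans hx2)
  rw [le_div_iff₀ hx0, one_mul] at hx1
  obtain ⟨z, hz, rfl⟩ := intermediate_value_Icc hx0.le hφ.continuous.continuousOn
    (show y ∈ Icc (φ 0) (φ x) from
      ⟨hφ.map_zero.trans_le hy, ((le_max_left y 1).trans hx2).trans hx1⟩)
  exact ⟨z, hz.1, rfl⟩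

theorem IsOrliczN.phiInv_nonneg (hφ : IsOrliczN φ) {y : ℝ} (hy : 0 ≤ y) : 0 ≤ phiInv φ y :=
  Function.invFunOn_mem (hφ.exists_map_eq hy)

theorem IsOrliczN.map_phiInv (hφ : IsOrliczN φ) {y : ℝ} (hy : 0 ≤ y) : φ (phiInv φ y) = y :=
  Function.invFunOn_eq (hφ.exists_map_eq hy)

end OrliczFunction

/-! ### Exponential moments and the norm `τ_φ` -/

section SubGaussian

variable {Ω : Type*} [MeasurableSpace Ω] {P : Measure Ω} {φ : ℝ → ℝ} {ξ η : Ω → ℝ}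

theorem IsSub.integrable_exp (hξ : IsSub φ P ξ) (l : ℝ) :
    Integrable (fun ω => Real.exp (l * ξ ω)) P := by
  obtain ⟨a, -, ha⟩ := hξ.exists_bound
  exact (ha l).1

/-- This is `1 + x ≤ exp x` with zero mean. It makes the logarithm in `tau` nonnegative, where
`phiInv` is a genuine inverse. -/
theorem IsSub.one_le_integral_exp [IsProbabilityMeasure P] (hξ : IsSub φ P ξ) (l : ℝ) :
    1 ≤ ∫ ω, Real.exp (l * ξ ω) ∂P := by
  have h : ∫ ω, (l * ξ ω + 1) ∂P ≤ ∫ ω, Real.exp (l * ξ ω) ∂P :=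
    integral_mono ((hξ.integrable.const_mul l).add (integrable_const 1)) (hξ.integrable_exp l)
      fun ω => Real.add_one_le_exp _
  rw [integral_add (hξ.integrable.const_mul l) (integrable_const 1), integral_const_mul,
    hξ.zero_mean] at h
  simpa using h

theorem IsSub.log_integral_exp_nonneg [IsProbabilityMeasure P] (hξ : IsSub φ P ξ) (l : ℝ) :
    0 ≤ Real.log (∫ ω, Real.exp (l * ξ ω) ∂P) :=
  Real.log_nonneg (hξ.one_le_integral_exp l)

/-- Every admissible `a` is an upper bound. Without boundedness the real supremum defining `tau`
would default to `0`. -/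
theorem IsSub.bddAbove_tau [IsProbabilityMeasure P] (hφ : IsOrliczN φ) (hξ : IsSub φ P ξ) :
    BddAbove (range fun l : {l : ℝ // l ≠ 0} =>
      phiInv φ (Real.log (∫ ω, Real.exp ((l : ℝ) * ξ ω) ∂P)) / |(l : ℝ)|) := by
  obtain ⟨a, ha0, ha⟩ := hξ.exists_bound
  refine ⟨a, ?_⟩
  rintro _ ⟨⟨l, hl⟩, rfl⟩
  have hlog := hξ.log_integral_exp_nonneg l
  rw [div_le_iff₀ (abs_pos.2 hl),
    ← hφ.strictMonoOn_Ici.le_iff_le (hφ.phiInv_nonneg hlog) (mem_Ici.2 (by positivity)),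
    hφ.map_phiInv hlog, ← abs_of_nonneg ha0, ← abs_mul, hφ.map_abs,
    Real.log_le_iff_le_exp (one_pos.trans_le (hξ.one_le_integral_exp l))]
  exact (ha l).2

theorem IsSub.tau_nonneg [IsProbabilityMeasure P] (hφ : IsOrliczN φ) (hξ : IsSub φ P ξ) :
    0 ≤ tau φ P ξ :=
  Real.iSup_nonneg fun _ =>
    div_nonneg (hφ.phiInv_nonneg (hξ.log_integral_exp_nonneg _)) (abs_nonneg _)

theorem IsSub.integral_exp_le [IsProbabilityMeasure P] (hφ : IsOrliczN φ) (hξ : IsSub φ P ξ)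
    (l : ℝ) : ∫ ω, Real.exp (l * ξ ω) ∂P ≤ Real.exp (φ (tau φ P ξ * l)) := by
  rcases eq_or_ne l 0 with rfl | hl
  · simp [hφ.map_zero]
  have hlog := hξ.log_integral_exp_nonneg l
  have h := le_ciSup (hξ.bddAbove_tau hφ) ⟨l, hl⟩
  change _ ≤ tau φ P ξ at h
  have hτ := hξ.tau_nonneg hφ
  rw [div_le_iff₀ (abs_pos.2 hl),
    ← hφ.strictMonoOn_Ici.le_iff_le (hφ.phiInv_nonneg hlog) (mem_Ici.2 (by positivity)),
    hφ.map_phiInv hlog, ← abs_of_nonneg hτ, ← abs_mul, hφ.map_abs,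
    Real.log_le_iff_le_exp (one_pos.trans_le (hξ.one_le_integral_exp l))] at h
  exact h

theorem IsSub.lintegral_exp_mul_abs_le [IsProbabilityMeasure P] (hφ : IsOrliczN φ)
    (hξ : IsSub φ P ξ) {l x : ℝ} (h : |tau φ P ξ * l| ≤ |x|) :
    ∫⁻ ω, ENNReal.ofReal (Real.exp (l * |ξ ω|)) ∂P ≤ 2 * ENNReal.ofReal (Real.exp (φ x)) := by
  have key : ∀ k : ℝ, |k| = |l| →
      ∫⁻ ω, ENNReal.ofReal (Real.exp (k * ξ ω)) ∂P ≤ ENNReal.ofReal (Real.exp (φ x)) := by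
    intro k hk
    rw [← ofReal_integral_eq_lintegral_ofReal (hξ.integrable_exp k)
      (ae_of_all _ fun ω => (Real.exp_pos _).le)]
    refine ENNReal.ofReal_le_ofReal ((hξ.integral_exp_le hφ k).trans
      (Real.exp_le_exp.2 (hφ.map_le_map ?_)))
    rwa [abs_mul, hk, ← abs_mul]
  calc ∫⁻ ω, ENNReal.ofReal (Real.exp (l * |ξ ω|)) ∂P
      ≤ ∫⁻ ω, (ENNReal.ofReal (Real.exp (l * ξ ω)) +
          ENNReal.ofReal (Real.exp (-l * ξ ω))) ∂P := by
        refine lintegral_mono fun ω => ?_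
        rcases abs_choice (ξ ω) with h | h
        · rw [h]; exact le_self_add
        · rw [h, mul_neg, ← neg_mul]; exact le_add_self
    _ = ∫⁻ ω, ENNReal.ofReal (Real.exp (l * ξ ω)) ∂P +
          ∫⁻ ω, ENNReal.ofReal (Real.exp (-l * ξ ω)) ∂P :=
        lintegral_add_left' (hξ.integrable_exp l).1.aemeasurable.ennreal_ofReal _
    _ ≤ 2 * ENNReal.ofReal (Real.exp (φ x)) := by
        rw [two_mul]
        exact add_le_add (key l rfl) (key (-l) (abs_neg l))

/-- Makes `tau` meaningful on increments. The constant need not be sharp, since only the existence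
of some bound matters. -/
theorem IsSub.sub (hφ : IsOrliczN φ) (hξ : IsSub φ P ξ) (hη : IsSub φ P η) :
    IsSub φ P (fun ω => ξ ω - η ω) where
  aemeasurable := hξ.aemeasurable.sub hη.aemeasurable
  integrable := hξ.integrable.sub hη.integrable
  zero_mean := by
    rw [integral_sub hξ.integrable hη.integrable, hξ.zero_mean, hη.zero_mean, sub_zero]
  exists_bound := by
    obtain ⟨a, ha0, ha⟩ := hξ.exists_bound
    obtain ⟨b, hb0, hb⟩ := hη.exists_bound
    refine ⟨2 * max a b, by positivity, fun l => ?_⟩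
    have hle : ∀ ω, Real.exp (l * (ξ ω - η ω)) ≤
        (Real.exp (2 * l * ξ ω) + Real.exp (-2 * l * η ω)) / 2 := by
      intro ω
      -- The inequality `2 x y ≤ x² + y²` separates the two variables without independence; doubling
      -- `l` accounts for the factor `2` in the bound.
      have h := two_mul_le_add_sq (Real.exp (l * ξ ω)) (Real.exp (-l * η ω))
      rw [mul_assoc, ← Real.exp_add, sq, sq, ← Real.exp_add, ← Real.exp_add] at h
      ring_nf at h ⊢
      linarith
    have hint : Integrable
        (fun ω => (Real.exp (2 * l * ξ ω) + Real.exp (-2 * l * η ω)) / 2) P :=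
      ((ha (2 * l)).1.add (hb (-2 * l)).1).div_const 2
    have hint' : Integrable (fun ω => Real.exp (l * (ξ ω - η ω))) P :=
      hint.mono' ((hξ.aemeasurable.sub hη.aemeasurable).const_mul l).exp.aestronglyMeasurable
        (ae_of_all _ fun ω => by
          rw [Real.norm_of_nonneg (Real.exp_pos _).le]
          exact hle ω)
    refine ⟨hint', (integral_mono hint' hint hle).trans ?_⟩
    rw [integral_div, integral_add (ha (2 * l)).1 (hb (-2 * l)).1]
    have h1 : φ (a * (2 * l)) ≤ φ (2 * max a b * l) := by
      refine hφ.map_le_map ?_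
      rw [abs_mul, abs_mul, abs_mul, abs_mul, abs_of_nonneg ha0,
        abs_of_nonneg (ha0.trans (le_max_left a b)), mul_left_comm, mul_assoc]
      gcongr
      exact le_max_left a b
    have h2 : φ (b * (-2 * l)) ≤ φ (2 * max a b * l) := by
      refine hφ.map_le_map ?_
      rw [abs_mul, abs_mul, abs_mul, abs_mul, abs_of_nonneg hb0, abs_neg,
        abs_of_nonneg (ha0.trans (le_max_left a b)), mul_left_comm, mul_assoc]
      gcongr
      exact le_max_right a b
    have h3 := (ha (2 * l)).2.trans (Real.exp_le_exp.2 h1)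
    have h4 := (hb (-2 * l)).2.trans (Real.exp_le_exp.2 h2)
    linarith

end SubGaussian

/-! ### Range of `r` and Jensen's inequality -/

section EntropyFunction

variable {r : ℝ → ℝ}

theorem exists_eq_of_convexOn_exp (hr_mono : StrictMonoOn r (Ici 1))
    (hr_convex : ConvexOn ℝ (Ici 0) fun x => r (Real.exp x)) {y : ℝ} (hy : r 1 ≤ y) :
    ∃ x ∈ Ici (1 : ℝ), r x = y := by
  set f : ℝ → ℝ := fun x => r (Real.exp x) with hf
  have hmono : ∀ {a b : ℝ}, 0 ≤ a → a < b → f a < f b := fun ha hab =>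
    hr_mono (Real.one_le_exp ha) (Real.one_le_exp (ha.trans hab.le)) (Real.exp_lt_exp.2 hab)
  have h01 : f 0 < f 1 := hmono le_rfl one_pos
  have hf0 : f 0 = r 1 := by simp [hf]
  -- Convexity gives continuity only in the interior. At the endpoint `f` is squeezed between `f 0`
  -- and its chord over `[0, 1]`.
  have hcont0 : ContinuousWithinAt f (Ici 0) 0 := by
    have hup : Tendsto (fun x : ℝ => f 0 + x * (f 1 - f 0)) (𝓝[≥] 0) (𝓝 (f 0)) := by
      have : Continuous fun x : ℝ => f 0 + x * (f 1 - f 0) := by fun_prop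
      simpa using (this.tendsto 0).mono_left nhdsWithin_le_nhds
    refine tendsto_of_tendsto_of_tendsto_of_le_of_le' tendsto_const_nhds hup ?_ ?_
    · filter_upwards [self_mem_nhdsWithin] with x hx
      rcases eq_or_lt_of_le (mem_Ici.1 hx) with rfl | hx
      · exact le_rfl
      · exact (hmono le_rfl hx).le
    · filter_upwards [self_mem_nhdsWithin,
        mem_nhdsWithin_of_mem_nhds (Iio_mem_nhds one_pos)] with x hx hx1
      have := hr_convex.2 (mem_Ici.2 le_rfl) (mem_Ici.2 zero_le_one)
        (sub_nonneg.2 (mem_Iio.1 hx1).le) (mem_Ici.1 hx) (by ring)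
      simp only [smul_eq_mul, mul_zero, mul_one, zero_add] at this
      change f x ≤ (1 - x) * f 0 + x * f 1 at this
      linarith
  have hcont : ContinuousOn f (Ici 0) := by
    intro x hx
    rcases eq_or_lt_of_le (mem_Ici.1 hx) with rfl | hx
    · exact hcont0
    · have h := hr_convex.continuousOn_interior
      rw [interior_Ici] at h
      exact (h.continuousAt (Ioi_mem_nhds hx)).continuousWithinAt
  obtain ⟨b, hb0, hb⟩ : ∃ b, 0 ≤ b ∧ y ≤ f b := by
    -- For `b ≥ 1` a convex function lies above the extended chord, `f b ≥ f 0 + b (f 1 - f 0)`;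
    -- this `b` makes the right side at least `y`.
    set b := max 1 ((y - f 0) / (f 1 - f 0)) with hbdef
    have hb1 : 1 ≤ b := le_max_left _ _
    have hb0 : 0 < b := one_pos.trans_le hb1
    refine ⟨b, hb0.le, ?_⟩
    have h := hr_convex.2 (mem_Ici.2 le_rfl) (mem_Ici.2 hb0.le)
      (sub_nonneg.2 (inv_le_one_of_one_le₀ hb1)) (inv_nonneg.2 hb0.le) (by ring)
    simp only [smul_eq_mul, mul_zero, zero_add, inv_mul_cancel₀ hb0.ne'] at h
    change f 1 ≤ (1 - b⁻¹) * f 0 + b⁻¹ * f b at h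
    have h2 : (y - f 0) / (f 1 - f 0) ≤ b := le_max_right _ _
    rw [div_le_iff₀ (sub_pos.2 h01)] at h2
    have h3 : b * (f 1 - f 0) ≤ f b - f 0 := by
      have := mul_le_mul_of_nonneg_left h hb0.le
      have e : b * ((1 - b⁻¹) * f 0 + b⁻¹ * f b) = b * f 0 - f 0 + f b := by
        field_simp
      rw [e] at this
      linarith
    linarith
  obtain ⟨z, hz, hzy⟩ := intermediate_value_Icc hb0 (hcont.mono Icc_subset_Ici_self)
    (show y ∈ Icc (f 0) (f b) from ⟨hf0.trans_le hy, hb⟩)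
  exact ⟨Real.exp z, Real.one_le_exp hz.1, hzy⟩

/-- The weighted geometric mean of numbers `a i ≥ 1` is at most `rInv r y` as soon as the weighted
arithmetic mean of the `r (a i)` is at most `y`. -/
theorem prod_rpow_le_rInv (hr_mono : StrictMonoOn r (Ici 1))
    (hr_convex : ConvexOn ℝ (Ici 0) fun x => r (Real.exp x)) {ι : Type*} (s : Finset ι)
    {w a : ι → ℝ} (hw : ∀ i ∈ s, 0 ≤ w i) (hw1 : ∑ i ∈ s, w i = 1) (ha : ∀ i ∈ s, 1 ≤ a i)
    {y : ℝ} (hy : ∑ i ∈ s, w i * r (a i) ≤ y) : ∏ i ∈ s, a i ^ w i ≤ rInv r y := by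
  have hprod : ∏ i ∈ s, a i ^ w i = Real.exp (∑ i ∈ s, w i * Real.log (a i)) := by
    rw [Real.exp_sum]
    refine Finset.prod_congr rfl fun i hi => ?_
    rw [Real.rpow_def_of_pos (one_pos.trans_le (ha i hi)), mul_comm]
  have h1 : 1 ≤ ∏ i ∈ s, a i ^ w i := by
    rw [hprod]
    exact Real.one_le_exp (Finset.sum_nonneg fun i hi =>
      mul_nonneg (hw i hi) (Real.log_nonneg (ha i hi)))
  have hjensen : r (∏ i ∈ s, a i ^ w i) ≤ y := by
    have h := hr_convex.map_sum_le hw hw1 (p := fun i => Real.log (a i))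
      fun i hi => Real.log_nonneg (ha i hi)
    simp only [smul_eq_mul] at h
    rw [hprod]
    refine (h.trans_eq (Finset.sum_congr rfl fun i hi => ?_)).trans hy
    rw [Real.exp_log (one_pos.trans_le (ha i hi))]
  -- This places `y` in the range of `r`, so `rInv r y` is a true preimage.
  have hr1 : r 1 ≤ y := (hr_mono.monotoneOn (mem_Ici.2 le_rfl) h1 h1).trans hjensen
  have hex := exists_eq_of_convexOn_exp hr_mono hr_convex hr1
  have hmem : rInv r y ∈ Ici (1 : ℝ) := Function.invFunOn_mem hex
  have heq : r (rInv r y) = y := Function.invFunOn_eq hex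
  rwa [← hr_mono.le_iff_le h1 hmem, heq]

end EntropyFunction

/-! ### Massiveness and lower sums of the entropy integral -/

section Massiveness

variable {T : Type*} {ρ : T → T → ℝ} {r : ℝ → ℝ}

theorem extend_coe (r : ℝ → ℝ) (n : ℕ) : extend r (n : ℕ∞) = ENNReal.ofReal (r n) := rfl

theorem massiveness_anti {u v : ℝ} (h : u ≤ v) : massiveness ρ v ≤ massiveness ρ u :=
  le_iInf₂ fun A hA => iInf₂_le A fun t =>
    let ⟨s, hs, hst⟩ := hA t
    ⟨s, hs, hst.trans h⟩

theorem one_le_massiveness [Nonempty T] (v : ℝ) : 1 ≤ massiveness ρ v := by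
  refine le_iInf₂ fun A hA => ?_
  obtain ⟨s, hs, -⟩ := hA (Classical.arbitrary T)
  exact_mod_cast Finset.card_pos.2 ⟨s, hs⟩

theorem exists_net_of_massiveness_ne_top {v : ℝ} (h : massiveness ρ v ≠ ⊤) :
    ∃ A : Finset T, (∀ t, ∃ s ∈ A, ρ s t ≤ v) ∧ (A.card : ℕ∞) = massiveness ρ v := by
  have hne : Nonempty {A : Finset T // ∀ t, ∃ s ∈ A, ρ s t ≤ v} := by
    by_contra hempty
    refine h ?_
    rw [massiveness, iInf_eq_top]
    intro A
    rw [iInf_eq_top]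
    exact fun hA => (hempty ⟨⟨A, hA⟩⟩).elim
  obtain ⟨⟨A, hA⟩, hmin⟩ := ENat.exists_eq_iInf
    fun A : {A : Finset T // ∀ t, ∃ s ∈ A, ρ s t ≤ v} => (A.1.card : ℕ∞)
  refine ⟨A, hA, ?_⟩
  rw [massiveness, iInf_subtype']
  exact hmin

theorem monotone_extend (hr_mono : StrictMonoOn r (Ici 1)) {m n : ℕ∞} (hm : 1 ≤ m)
    (h : m ≤ n) : extend r m ≤ extend r n := by
  induction n using ENat.recTopCoe with
  | top => exact le_top
  | coe n =>
    induction m using ENat.recTopCoe with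
    | top => simp at h
    | coe m =>
      have hm' : 1 ≤ m := by exact_mod_cast hm
      have h' : m ≤ n := by exact_mod_cast h
      exact ENNReal.ofReal_le_ofReal (hr_mono.monotoneOn (mem_Ici.2 (by exact_mod_cast hm'))
        (mem_Ici.2 (by exact_mod_cast hm'.trans h')) (by exact_mod_cast h'))

theorem const_mul_le_setLIntegral (hr_mono : StrictMonoOn r (Ici 1)) {a b : ℝ} {n : ℕ∞}
    (hn : 1 ≤ n) (h : n ≤ massiveness ρ b) :
    ENNReal.ofReal (b - a) * extend r n ≤ ∫⁻ u in Ioc a b, extend r (massiveness ρ u) := by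
  rw [mul_comm, ← Real.volume_Ioc, ← setLIntegral_const]
  exact setLIntegral_mono' measurableSet_Ioc fun u hu =>
    monotone_extend hr_mono hn (h.trans (massiveness_anti hu.2))

theorem massiveness_ne_top (hr_mono : StrictMonoOn r (Ici 1)) {v : ℝ} (hv : 0 < v)
    (hI : entropyIntegral r ρ v < ⊤) : massiveness ρ v ≠ ⊤ := by
  intro h
  refine hI.ne (top_le_iff.1 ?_)
  have := const_mul_le_setLIntegral (ρ := ρ) hr_mono (a := 0) (n := ⊤) le_top h.ge
  refine le_trans ?_ this
  rw [sub_zero, show extend r ⊤ = ⊤ from rfl, ENNReal.mul_top (by simpa using hv)]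

/-- On `(θ ^ (k+1) v, θ ^ k v]` the massiveness is at least its value at the right end; on the
remainder `(0, θ ^ m v]` it is at least one. The induction peels off the top interval and rescales
`v` to `θ v`. -/
theorem sum_le_entropyIntegral [Nonempty T] (hr_mono : StrictMonoOn r (Ici 1)) {θ : ℝ}
    (hθ0 : 0 < θ) (hθ1 : θ < 1) (m : ℕ) {v : ℝ} (hv : 0 < v) :
    ∑ k ∈ Finset.range m,
        ENNReal.ofReal ((1 - θ) * θ ^ k * v) * extend r (massiveness ρ (θ ^ k * v)) +
      ENNReal.ofReal (θ ^ m * v) * extend r 1 ≤ entropyIntegral r ρ v := by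
  induction m generalizing v with
  | zero =>
    simpa [entropyIntegral] using const_mul_le_setLIntegral (ρ := ρ) hr_mono (a := 0) (b := v) le_rfl
      (one_le_massiveness v)
  | succ m ih =>
    have hθv : θ * v ≤ v := by nlinarith
    have hsplit : entropyIntegral r ρ v =
        entropyIntegral r ρ (θ * v) + ∫⁻ u in Ioc (θ * v) v, extend r (massiveness ρ u) := by
      rw [entropyIntegral, ← Ioc_union_Ioc_eq_Ioc (by positivity) hθv,
        lintegral_union measurableSet_Ioc (Ioc_disjoint_Ioc_of_le le_rfl)]
      rfl
    have h1 := ih (v := θ * v) (by positivity)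
    have h2 := const_mul_le_setLIntegral (ρ := ρ) hr_mono (a := θ * v) (b := v)
      (one_le_massiveness v) le_rfl
    rw [hsplit, Finset.sum_range_succ', add_right_comm]
    refine add_le_add (le_trans (le_of_eq ?_) h1) (le_trans (le_of_eq ?_) h2)
    · congr 1
      · refine Finset.sum_congr rfl fun k _ => ?_
        rw [show (1 - θ) * θ ^ (k + 1) * v = (1 - θ) * θ ^ k * (θ * v) by ring,
          show θ ^ (k + 1) * v = θ ^ k * (θ * v) by ring]
      · rw [show θ ^ (m + 1) * v = θ ^ m * (θ * v) by ring]
    · rw [show (1 - θ) * θ ^ 0 * v = v - θ * v by ring, show θ ^ 0 * v = v by ring]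

end Massiveness

/-! ### Chaining and Hölder's inequality -/

section Chaining

variable {Ω T : Type*}

/-- The increments of `X` along the chain `…, π 1 (π 2 t), π 2 t, t`: the variable itself at level
`0`, and the difference of the values at `π k t` and at `t` at level `k + 1`. -/
def chainIncrement (X : T → Ω → ℝ) (π : ℕ → T → T) : ℕ → T → Ω → ℝ
  | 0, t => X t
  | k + 1, t => fun ω => X (π k t) ω - X t ω

theorem ofReal_exp_mul_le_sum_rpow {A : Finset T} {Y : T → ℝ} {t : T} (ht : t ∈ A) {l w : ℝ}
    (hw : 0 < w) : ENNReal.ofReal (Real.exp (l * Y t)) ≤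
      (∑ s ∈ A, ENNReal.ofReal (Real.exp (l / w * Y s))) ^ w := by
  have h : ENNReal.ofReal (Real.exp (l / w * Y t)) ≤
      ∑ s ∈ A, ENNReal.ofReal (Real.exp (l / w * Y s)) :=
    Finset.single_le_sum (f := fun s => ENNReal.ofReal (Real.exp (l / w * Y s)))
      (fun _ _ => zero_le) ht
  refine le_trans (le_of_eq ?_) (ENNReal.rpow_le_rpow h hw.le)
  rw [ENNReal.ofReal_rpow_of_pos (Real.exp_pos _), ← Real.exp_mul]
  congr 2
  field_simp

/-- Summing over a whole level frees the right side of `t`, so it also bounds the supremum over the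
last level. -/
theorem ofReal_exp_mul_abs_le_prod {X : T → Ω → ℝ} {π : ℕ → T → T} {A : ℕ → Finset T}
    {w : ℕ → ℝ} {l : ℝ} (hl : 0 ≤ l) (ω : Ω) (m : ℕ) (hw : ∀ k ≤ m, 0 < w k)
    (hπ : ∀ k < m, ∀ t, π k t ∈ A k) {t : T} (ht : t ∈ A m) :
    ENNReal.ofReal (Real.exp (l * |X t ω|)) ≤ ∏ k ∈ Finset.range (m + 1),
      (∑ s ∈ A k, ENNReal.ofReal (Real.exp (l / w k * |chainIncrement X π k s ω|))) ^ w k := by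
  induction m generalizing t with
  | zero =>
    rw [zero_add, Finset.prod_range_one]
    exact ofReal_exp_mul_le_sum_rpow (Y := fun s => |chainIncrement X π 0 s ω|) ht (hw 0 le_rfl)
  | succ m ih =>
    rw [Finset.prod_range_succ]
    have h1 := ih (fun k hk => hw k (hk.trans m.le_succ))
      (fun k hk => hπ k (hk.trans m.lt_succ_self)) (hπ m m.lt_succ_self t)
    have h2 := ofReal_exp_mul_le_sum_rpow (Y := fun s => |chainIncrement X π (m + 1) s ω|)
      (l := l) ht (hw (m + 1) le_rfl)
    refine le_trans ?_ (mul_le_mul' h1 h2)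
    rw [← ENNReal.ofReal_mul (Real.exp_pos _).le, ← Real.exp_add, ← mul_add]
    refine ENNReal.ofReal_le_ofReal (Real.exp_le_exp.2 (mul_le_mul_of_nonneg_left ?_ hl))
    have h := abs_sub (X (π m t) ω) (X (π m t) ω - X t ω)
    rwa [sub_sub_cancel] at h

variable [MeasurableSpace Ω] {P : Measure Ω} {φ : ℝ → ℝ}
  {X : T → Ω → ℝ}

theorem isSub_chainIncrement (hφ : IsOrliczN φ) (hX : ∀ t, IsSub φ P (X t)) (π : ℕ → T → T)
    (k : ℕ) (t : T) : IsSub φ P (chainIncrement X π k t) :=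
  match k with
  | 0 => hX t
  | k + 1 => (hX (π k t)).sub hφ (hX t)

/-- Hölder with exponents `1 / w k` needs no independence between levels. -/
theorem lintegral_iSup_exp_le_prod [IsProbabilityMeasure P] (hφ : IsOrliczN φ) (hX : ∀ t, IsSub φ P (X t))
    {π : ℕ → T → T} {A : ℕ → Finset T} {w : ℕ → ℝ} {l x : ℝ} (hl : 0 ≤ l) (m : ℕ)
    (hw : ∀ k ≤ m, 0 < w k) (hw1 : ∑ k ∈ Finset.range (m + 1), w k = 1)
    (hπ : ∀ k < m, ∀ t, π k t ∈ A k)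
    (hτ : ∀ k ≤ m, ∀ t, l / w k * tau φ P (chainIncrement X π k t) ≤ x) :
    ∫⁻ ω, ⨆ t : A m, ENNReal.ofReal (Real.exp (l * |X t ω|)) ∂P ≤ ENNReal.ofReal
      (2 * (Real.exp (φ x) * ∏ k ∈ Finset.range (m + 1), ((A k).card : ℝ) ^ w k)) := by
  have hle : ∀ k ∈ Finset.range (m + 1), k ≤ m := fun k hk =>
    Nat.lt_succ_iff.1 (Finset.mem_range.1 hk)
  have hmeas : ∀ k s, AEMeasurable
      (fun ω => ENNReal.ofReal (Real.exp (l / w k * |chainIncrement X π k s ω|))) P := by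
    intro k s
    exact (((isSub_chainIncrement hφ hX π k s).aemeasurable.abs).const_mul _).exp.ennreal_ofReal
  calc ∫⁻ ω, ⨆ t : A m, ENNReal.ofReal (Real.exp (l * |X t ω|)) ∂P
      ≤ ∫⁻ ω, ∏ k ∈ Finset.range (m + 1), (∑ s ∈ A k,
          ENNReal.ofReal (Real.exp (l / w k * |chainIncrement X π k s ω|))) ^ w k ∂P :=
        lintegral_mono fun ω => iSup_le fun t => ofReal_exp_mul_abs_le_prod hl ω m hw hπ t.2
    _ ≤ ∏ k ∈ Finset.range (m + 1), (∫⁻ ω, ∑ s ∈ A k,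
          ENNReal.ofReal (Real.exp (l / w k * |chainIncrement X π k s ω|)) ∂P) ^ w k :=
        ENNReal.lintegral_prod_norm_pow_le _
          (fun k _ => Finset.aemeasurable_fun_sum _ fun s _ => hmeas k s) hw1
          fun k hk => (hw k (hle k hk)).le
    _ ≤ ∏ k ∈ Finset.range (m + 1),
          ENNReal.ofReal ((2 * Real.exp (φ x)) ^ w k * ((A k).card : ℝ) ^ w k) := by
        refine Finset.prod_le_prod' fun k hk => ?_
        have hwk := hw k (hle k hk)
        rw [← Real.mul_rpow (by positivity) (by positivity),
          ← ENNReal.ofReal_rpow_of_nonneg (by positivity) hwk.le]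
        refine ENNReal.rpow_le_rpow ?_ hwk.le
        rw [lintegral_finsetSum' _ fun s _ => hmeas k s]
        refine (Finset.sum_le_card_nsmul _ _ (2 * ENNReal.ofReal (Real.exp (φ x)))
          fun s _ => ?_).trans_eq ?_
        · have hsub := isSub_chainIncrement hφ hX π k s
          refine hsub.lintegral_exp_mul_abs_le hφ ?_
          have h0 : 0 ≤ l / w k * tau φ P (chainIncrement X π k s) :=
            mul_nonneg (div_nonneg hl hwk.le) (hsub.tau_nonneg hφ)
          have h1 := hτ k (hle k hk) s
          rw [mul_comm, abs_of_nonneg h0, abs_of_nonneg (h0.trans h1)]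
          exact h1
        · rw [nsmul_eq_mul, mul_comm (2 * Real.exp (φ x)),
            ENNReal.ofReal_mul (Nat.cast_nonneg _), ENNReal.ofReal_mul zero_le_two,
            ENNReal.ofReal_natCast, ENNReal.ofReal_ofNat]
    _ = _ := by
        rw [← ENNReal.ofReal_prod_of_nonneg fun k _ => by positivity, Finset.prod_mul_distrib,
          ← Real.rpow_sum_of_pos (by positivity), hw1, Real.rpow_one, mul_assoc]

end Chaining

/-! ### Entropy means and geometric weights -/

theorem one_le_rInv {r : ℝ → ℝ} (hr_mono : StrictMonoOn r (Ici 1))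
    (hr_convex : ConvexOn ℝ (Ici 0) fun x => r (Real.exp x)) {y : ℝ} (hy : r 1 ≤ y) :
    1 ≤ rInv r y :=
  Function.invFunOn_mem (exists_eq_of_convexOn_exp hr_mono hr_convex hy)

section EntropyMean

variable {T : Type*} [Nonempty T] {ρ : T → T → ℝ} {r : ℝ → ℝ}

theorem sum_mul_le_entropyMean (hr_nonneg : ∀ x, 1 ≤ x → 0 ≤ r x)
    (hr_mono : StrictMonoOn r (Ici 1)) {θ v : ℝ} (hθ0 : 0 < θ) (hθ1 : θ < 1) (hv : 0 < v)
    (hI : entropyIntegral r ρ v < ⊤) {n : ℕ → ℕ}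
    (hn : ∀ k, (n k : ℕ∞) = massiveness ρ (θ ^ k * v)) (m : ℕ) :
    ∑ k ∈ Finset.range m, (1 - θ) * θ ^ k * r (n k) + θ ^ m * r 1 ≤
      (entropyIntegral r ρ v).toReal / v := by
  have hn1 : ∀ k, (1 : ℝ) ≤ n k := fun k => by
    have h := one_le_massiveness (ρ := ρ) (θ ^ k * v)
    rw [← hn k] at h
    exact_mod_cast h
  have hθ : 0 < 1 - θ := sub_pos.2 hθ1
  have h := sum_le_entropyIntegral (ρ := ρ) hr_mono hθ0 hθ1 m hv
  have hr0 := hr_nonneg 1 le_rfl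
  have hone : extend r 1 = ENNReal.ofReal (r 1) := by
    simpa using extend_coe r 1
  have hsum : ∑ k ∈ Finset.range m,
        ENNReal.ofReal ((1 - θ) * θ ^ k * v) * extend r (massiveness ρ (θ ^ k * v)) =
      ENNReal.ofReal (∑ k ∈ Finset.range m, (1 - θ) * θ ^ k * v * r (n k)) := by
    rw [ENNReal.ofReal_sum_of_nonneg fun k _ =>
      mul_nonneg (by positivity) (hr_nonneg _ (hn1 k))]
    refine Finset.sum_congr rfl fun k _ => ?_
    rw [← hn k, extend_coe, ← ENNReal.ofReal_mul (by positivity)]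
  rw [hsum, hone, ← ENNReal.ofReal_mul (by positivity), ← ENNReal.ofReal_add
    (Finset.sum_nonneg fun k _ => mul_nonneg (by positivity) (hr_nonneg _ (hn1 k)))
    (by positivity), ENNReal.ofReal_le_iff_le_toReal hI.ne] at h
  rw [le_div_iff₀ hv, add_mul, Finset.sum_mul]
  refine le_trans (le_of_eq ?_) h
  congr 1
  · exact Finset.sum_congr rfl fun k _ => by ring
  · ring

theorem le_entropyMean (hr_mono : StrictMonoOn r (Ici 1)) {v : ℝ} (hv : 0 < v)
    (hI : entropyIntegral r ρ v < ⊤) : r 1 ≤ (entropyIntegral r ρ v).toReal / v := by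
  rw [le_div_iff₀ hv, mul_comm, ← ENNReal.ofReal_le_iff_le_toReal hI.ne]
  have h := const_mul_le_setLIntegral (ρ := ρ) hr_mono (a := 0) le_rfl (one_le_massiveness v)
  rw [sub_zero, show extend r 1 = ENNReal.ofReal (r 1) by simpa using extend_coe r 1,
    ← ENNReal.ofReal_mul hv.le] at h
  exact h

end EntropyMean

theorem sum_geometric_weights (θ : ℝ) (m : ℕ) :
    ∑ k ∈ Finset.range m, (1 - θ) * θ ^ k + θ ^ m = 1 := by
  rw [← Finset.mul_sum, mul_neg_geom_sum, sub_add_cancel]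

/-! ### Exponential moment of the supremum over a finite set -/

section Supremum

variable {Ω : Type*} [MeasurableSpace Ω] {P : Measure Ω} [IsProbabilityMeasure P]
  {T : Type*} [Nonempty T] {φ : ℝ → ℝ} {X : T → Ω → ℝ} {r : ℝ → ℝ}

theorem lintegral_iSup_exp_le_mul_card_rpow (hφ : IsOrliczN φ) (hX : ∀ t, IsSub φ P (X t))
    (hbdd : BddAbove (range fun t => tau φ P (X t))) (hpos : 0 < epsZero φ P X)
    (hr_nonneg : ∀ x, 1 ≤ x → 0 ≤ r x) (hr_mono : StrictMonoOn r (Ici 1))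
    (hr_convex : ConvexOn ℝ (Ici 0) fun x => r (Real.exp x))
    (hI : ∀ v : ℝ, 0 < v → entropyIntegral r (rho φ P X) v < ⊤) {l θ : ℝ} (hl : 0 < l)
    (hθ0 : 0 < θ) (hθ1 : θ < 1) (F : Finset T) (m : ℕ) :
    ∫⁻ ω, ⨆ t : F, ENNReal.ofReal (Real.exp (l * |X t ω|)) ∂P ≤
      ENNReal.ofReal (2 * (Real.exp (φ (l * epsZero φ P X / (1 - θ))) *
        (rInv r ((entropyIntegral r (rho φ P X) (θ * epsZero φ P X)).toReal /
          (θ * epsZero φ P X)) * (F.card : ℝ) ^ (θ ^ m)))) := by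
  set ε := epsZero φ P X with hε
  set ρ := rho φ P X with hρ
  have hθ : 0 < 1 - θ := sub_pos.2 hθ1
  have hv : 0 < θ * ε := mul_pos hθ0 hpos
  choose B hB hBcard using fun k : ℕ => exists_net_of_massiveness_ne_top
    (massiveness_ne_top (ρ := ρ) hr_mono (v := θ ^ k * (θ * ε)) (by positivity)
      (hI _ (by positivity)))
  choose π hπB hπρ using hB
  have hB1 : ∀ k, (1 : ℝ) ≤ (B k).card := fun k => by
    exact_mod_cast Finset.card_pos.2 ⟨_, hπB k (Classical.arbitrary T)⟩
  -- The last level is `F` itself, with weight `θ ^ m`, the tail of the geometric series. In `a` its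
  -- cardinality is replaced by `1`, so that Jensen's inequality sees only the nets and `(card F) ^
  -- (θ ^ m)` splits off.
  let A : ℕ → Finset T := fun k => if k < m then B k else F
  let w : ℕ → ℝ := fun k => if k < m then (1 - θ) * θ ^ k else θ ^ m
  let a : ℕ → ℝ := fun k => if k < m then (B k).card else 1
  have hAm : A m = F := if_neg (lt_irrefl m)
  have hwm : w m = θ ^ m := if_neg (lt_irrefl m)
  have ham : a m = 1 := if_neg (lt_irrefl m)
  have hA : ∀ k < m, A k = B k := fun k hk => if_pos hk
  have hw : ∀ k < m, w k = (1 - θ) * θ ^ k := fun k hk => if_pos hk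
  have ha : ∀ k < m, a k = (B k).card := fun k hk => if_pos hk
  have hwpos : ∀ k, 0 < w k := by
    intro k
    by_cases hk : k < m
    · rw [hw k hk]; positivity
    · rw [show w k = θ ^ m from if_neg hk]; positivity
  have ha1 : ∀ k, 1 ≤ a k := by
    intro k
    by_cases hk : k < m
    · rw [ha k hk]; exact hB1 k
    · exact (if_neg hk : a k = 1).ge
  have hw1 : ∑ k ∈ Finset.range (m + 1), w k = 1 := by
    rw [Finset.sum_range_succ, hwm, ← sum_geometric_weights θ m]
    exact congrArg (· + θ ^ m)
      (Finset.sum_congr rfl fun k hk => hw k (Finset.mem_range.1 hk))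
  have hτε : ∀ k t, tau φ P (chainIncrement X π k t) ≤ θ ^ k * ε := by
    rintro (_ | k) t
    · rw [pow_zero, one_mul]
      exact le_ciSup hbdd t
    · rw [pow_succ, mul_assoc]
      exact hπρ k t
  have hτ : ∀ k ≤ m, ∀ t, l / w k * tau φ P (chainIncrement X π k t) ≤ l * ε / (1 - θ) := by
    intro k hk t
    refine (mul_le_mul_of_nonneg_left (hτε k t)
      (div_nonneg hl.le (hwpos k).le)).trans ?_
    rcases hk.lt_or_eq with hk | rfl
    · rw [hw k hk]
      apply le_of_eq
      field_simp
    -- The last weight lacks the factor `1 - θ`, so this level gives `l ε`, which is smaller than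
    -- needed.
    · rw [hwm, le_div_iff₀ hθ, show l / θ ^ k * (θ ^ k * ε) = l * ε by field_simp]
      nlinarith [mul_pos hl hpos]
  have hmain := lintegral_iSup_exp_le_prod hφ hX (π := π) (A := A) hl.le m
    (fun k _ => hwpos k) hw1 (fun k hk t => by rw [hA k hk]; exact hπB k t) hτ
  rw [hAm] at hmain
  refine hmain.trans (ENNReal.ofReal_le_ofReal ?_)
  have hprod : ∏ k ∈ Finset.range (m + 1), ((A k).card : ℝ) ^ w k =
      (∏ k ∈ Finset.range (m + 1), a k ^ w k) * (F.card : ℝ) ^ (θ ^ m) := by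
    rw [Finset.prod_range_succ, Finset.prod_range_succ, hAm, hwm, ham, Real.one_rpow, mul_one]
    congr 1
    refine Finset.prod_congr rfl fun k hk => ?_
    rw [hA k (Finset.mem_range.1 hk), ha k (Finset.mem_range.1 hk)]
  rw [hprod]
  gcongr
  refine prod_rpow_le_rInv hr_mono hr_convex _ (fun k _ => (hwpos k).le) hw1 (fun k _ => ha1 k)
    (le_trans (le_of_eq ?_)
      (sum_mul_le_entropyMean (ρ := ρ) hr_nonneg hr_mono hθ0 hθ1 hv (hI _ hv) hBcard m))
  rw [Finset.sum_range_succ, hwm, ham]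
  congr 1
  refine Finset.sum_congr rfl fun k hk => ?_
  rw [hw k (Finset.mem_range.1 hk), ha k (Finset.mem_range.1 hk)]

/-- The number of levels `m` is free while `F` is fixed, and `(card F) ^ (θ ^ m) → 1`. -/
theorem lintegral_iSup_finset_exp_le (hφ : IsOrliczN φ) (hX : ∀ t, IsSub φ P (X t))
    (hbdd : BddAbove (range fun t => tau φ P (X t))) (hpos : 0 < epsZero φ P X)
    (hr_nonneg : ∀ x, 1 ≤ x → 0 ≤ r x) (hr_mono : StrictMonoOn r (Ici 1))
    (hr_convex : ConvexOn ℝ (Ici 0) fun x => r (Real.exp x))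
    (hI : ∀ v : ℝ, 0 < v → entropyIntegral r (rho φ P X) v < ⊤) {l θ : ℝ} (hl : 0 < l)
    (hθ0 : 0 < θ) (hθ1 : θ < 1) {F : Finset T} (hF : F.Nonempty) :
    ∫⁻ ω, ⨆ t : F, ENNReal.ofReal (Real.exp (l * |X t ω|)) ∂P ≤
      ENNReal.ofReal (2 * (Real.exp (φ (l * epsZero φ P X / (1 - θ))) *
        rInv r ((entropyIntegral r (rho φ P X) (θ * epsZero φ P X)).toReal /
          (θ * epsZero φ P X)))) := by
  have hcard : (F.card : ℝ) ≠ 0 := by exact_mod_cast hF.card_ne_zero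
  have hlim : Tendsto (fun m : ℕ => (F.card : ℝ) ^ (θ ^ m)) atTop (𝓝 1) := by
    have h := (Real.continuousAt_const_rpow (b := 0) hcard).tendsto.comp
      (tendsto_pow_atTop_nhds_zero_of_lt_one hθ0.le hθ1)
    rwa [Real.rpow_zero] at h
  refine ge_of_tendsto' (x := atTop) (ENNReal.tendsto_ofReal ?_) fun m : ℕ =>
    lintegral_iSup_exp_le_mul_card_rpow hφ hX hbdd hpos hr_nonneg hr_mono hr_convex hI hl
      hθ0 hθ1 F m
  simpa only [mul_one] using ((hlim.const_mul _).const_mul _).const_mul 2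

end Supremum

/-! ### From finite sets to the whole parameter set -/

section Separability

variable {Ω : Type*} [MeasurableSpace Ω] {P : Measure Ω} {T : Type*} {X : T → Ω → ℝ}

theorem IsSeparableProcess.exists_seq [Nonempty T] {ρ : T → T → ℝ}
    (h : IsSeparableProcess ρ P X) :
    ∃ s : ℕ → T, ∀ᵐ ω ∂P, supAbs X ω = ⨆ n, ((|X (s n) ω| : ℝ) : EReal) := by
  obtain ⟨S, hS, hdense, hae⟩ := h
  obtain ⟨s₀, hs₀, -⟩ := hdense (Classical.arbitrary T) 1 one_pos
  obtain ⟨s, rfl⟩ := hS.exists_eq_range ⟨s₀, hs₀⟩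
  refine ⟨s, hae.mono fun ω hω => le_antisymm (iSup_le fun t => ?_)
    (iSup_le fun n => le_iSup (fun t => ((|X t ω| : ℝ) : EReal)) (s n))⟩
  set M := ⨆ n, ((|X (s n) ω| : ℝ) : EReal) with hM
  have hle : ∀ n, ((|X (s n) ω| : ℝ) : EReal) ≤ M :=
    fun n => le_iSup (fun n => ((|X (s n) ω| : ℝ) : EReal)) n
  rcases eq_or_ne M ⊤ with htop | htop
  · rw [htop]; exact le_top
  have hbot : M ≠ ⊥ := fun hb => by
    have := hle 0
    rw [hb, le_bot_iff] at this
    exact EReal.coe_ne_bot _ this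
  lift M to ℝ using ⟨htop, hbot⟩ with c hc
  -- Separability is applied with `U` the whole space and `D = [-c, c]`, where `c` is the finite
  -- supremum over the sequence.
  have h := hω univ (fun t _ => ⟨1, one_pos, fun s _ => mem_univ s⟩) (Icc (-c) c) isClosed_Icc
    ordConnected_Icc (by
      rintro _ ⟨-, n, rfl⟩
      exact abs_le.1 (EReal.coe_le_coe_iff.1 (hle n))) t (mem_univ t)
  exact EReal.coe_le_coe_iff.2 (abs_le.2 h)

theorem monotone_exp_mul {l : ℝ} (hl : 0 ≤ l) :
    Monotone fun x : EReal => EReal.exp ((l : EReal) * x) := fun _ _ h =>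
  EReal.exp_monotone (mul_le_mul_of_nonneg_left h (EReal.coe_nonneg.2 hl))

/-- Taking logarithms turns the claim into an upper bound for each `f i`, so monotonicity suffices
and continuity is not needed. -/
theorem exp_mul_iSup_le {ι : Sort*} {l : ℝ} (hl : 0 < l) (f : ι → ℝ) :
    EReal.exp ((l : EReal) * ⨆ i, (f i : EReal)) ≤
      ⨆ i, ENNReal.ofReal (Real.exp (l * f i)) := by
  set B := ⨆ i, ENNReal.ofReal (Real.exp (l * f i)) with hB
  have hl' : (0 : EReal) < l := EReal.coe_pos.2 hl
  have h : (⨆ i, (f i : EReal)) ≤ ENNReal.log B / l := by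
    refine iSup_le fun i => ?_
    rw [EReal.le_div_iff_mul_le hl' (EReal.coe_ne_top l), ← EReal.exp_le_exp_iff,
      ENNReal.exp_log, mul_comm, ← EReal.coe_mul, EReal.exp_coe]
    exact le_iSup (fun i => ENNReal.ofReal (Real.exp (l * f i))) i
  rw [EReal.le_div_iff_mul_le hl' (EReal.coe_ne_top l), mul_comm] at h
  simpa using EReal.exp_monotone h

theorem lintegral_exp_supAbs_le {s : ℕ → T} (hXm : ∀ t, AEMeasurable (X t) P)
    (hs : ∀ᵐ ω ∂P, supAbs X ω = ⨆ n, ((|X (s n) ω| : ℝ) : EReal)) {l : ℝ} (hl : 0 < l)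
    {C : ℝ≥0∞} (hC : ∀ F : Finset T, F.Nonempty →
      ∫⁻ ω, ⨆ t : F, ENNReal.ofReal (Real.exp (l * |X t ω|)) ∂P ≤ C) :
    ∫⁻ ω, EReal.exp ((l : EReal) * supAbs X ω) ∂P ≤ C := by
  classical
  let F : ℕ → Finset T := fun n => (Finset.range (n + 1)).image s
  have hF : ∀ n, s n ∈ F n := fun n =>
    Finset.mem_image_of_mem s (Finset.mem_range.2 n.lt_succ_self)
  have hmono : Monotone F := fun m n h =>
    Finset.image_subset_image (Finset.range_mono (Nat.succ_le_succ h))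
  calc ∫⁻ ω, EReal.exp ((l : EReal) * supAbs X ω) ∂P
      ≤ ∫⁻ ω, ⨆ n, ⨆ t : F n, ENNReal.ofReal (Real.exp (l * |X t ω|)) ∂P := by
        refine lintegral_mono_ae (hs.mono fun ω hω => ?_)
        rw [hω]
        refine (exp_mul_iSup_le hl _).trans (iSup_mono fun n => ?_)
        exact le_iSup (fun t : F n => ENNReal.ofReal (Real.exp (l * |X t ω|))) ⟨s n, hF n⟩
    _ = ⨆ n, ∫⁻ ω, ⨆ t : F n, ENNReal.ofReal (Real.exp (l * |X t ω|)) ∂P := by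
        refine lintegral_iSup' (fun n => AEMeasurable.iSup fun t =>
          ((hXm t).abs.const_mul l).exp.ennreal_ofReal) (ae_of_all _ fun ω m n h => ?_)
        exact iSup_le fun t =>
          le_iSup (fun t : F n => ENNReal.ofReal (Real.exp (l * |X t ω|))) ⟨t, hmono h t.2⟩
    _ ≤ C := iSup_le fun n => hC (F n) ⟨s n, hF n⟩

theorem exp_mul_measure_le_lintegral (hm : AEMeasurable (supAbs X) P) {l : ℝ} (hl : 0 ≤ l)
    (u : ℝ) : ENNReal.ofReal (Real.exp (l * u)) * P {ω | (u : EReal) ≤ supAbs X ω} ≤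
      ∫⁻ ω, EReal.exp ((l : EReal) * supAbs X ω) ∂P := by
  refine le_trans (mul_le_mul' le_rfl (measure_mono fun ω hω => ?_)) (mul_meas_ge_le_lintegral₀
    ((monotone_exp_mul hl).measurable.comp_aemeasurable hm) (ENNReal.ofReal (Real.exp (l * u))))
  have h := monotone_exp_mul hl hω
  simp only [← EReal.coe_mul, EReal.exp_coe] at h
  exact h

end Separability

/-- Optimization of an exponential bound over its parameter. -/
theorem le_mul_exp_neg_youngFenchel {φ : ℝ → ℝ} (hφ : IsOrliczN φ) {p c x : ℝ} (hx : 0 ≤ x)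
    (hc : 0 ≤ c) (hpc : p ≤ c) (h : ∀ y, 0 < y → Real.exp (x * y) * p ≤ c * Real.exp (φ y)) :
    p ≤ c * Real.exp (-youngFenchel φ x) := by
  rcases le_or_gt p 0 with hp | hp
  · exact hp.trans (by positivity)
  have hc : 0 < c := hp.trans_le hpc
  have hsup : youngFenchel φ x ≤ Real.log (c / p) := by
    refine ciSup_le fun y => ?_
    -- For `y ≤ 0` the quantity `x y - φ y` is nonpositive, and `p ≤ c` makes the logarithm
    -- nonnegative.
    rcases le_or_gt y 0 with hy | hy
    · have h1 := Real.log_nonneg ((one_le_div hp).2 hpc)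
      have h2 := hφ.nonneg y
      have h3 := mul_nonpos_of_nonneg_of_nonpos hx hy
      linarith
    · rw [Real.le_log_iff_exp_le (by positivity), Real.exp_sub,
        div_le_div_iff₀ (Real.exp_pos _) hp]
      exact h y hy
  rw [Real.le_log_iff_exp_le (by positivity), le_div_iff₀ hp] at hsup
  rw [Real.exp_neg, ← div_eq_mul_inv, le_div_iff₀ (Real.exp_pos _), mul_comm]
  exact hsup

end PhiSub

/-! ### Conclusion: Markov's inequality and optimization -/

theorem theorem5 {Ω : Type*} [MeasurableSpace Ω] (P : Measure Ω) [IsProbabilityMeasure P]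
    {T : Type*} [Nonempty T] (φ : ℝ → ℝ) (hφ : PhiSub.IsOrliczN φ) (hQ : PhiSub.ConditionQ φ)
    (X : T → Ω → ℝ) (hX : ∀ t, PhiSub.IsSub φ P (X t))
    (hT : PhiSub.IsRhoSeparable (PhiSub.rho φ P X))
    (hsep : PhiSub.IsSeparableProcess (PhiSub.rho φ P X) P X)
    (hbdd : BddAbove (Set.range fun t => PhiSub.tau φ P (X t)))
    (hpos : 0 < PhiSub.epsZero φ P X)
    (r : ℝ → ℝ) (hr_nonneg : ∀ x, 1 ≤ x → 0 ≤ r x) (hr_mono : StrictMonoOn r (Set.Ici 1))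
    (hr_convex : ConvexOn ℝ (Set.Ici 0) fun x => r (Real.exp x))
    (hI : ∀ v : ℝ, 0 < v → PhiSub.entropyIntegral r (PhiSub.rho φ P X) v < ⊤) :
    AEMeasurable (PhiSub.supAbs X) P ∧
    (∀ l θ : ℝ, 0 < l → 0 < θ → θ < 1 →
      ∫⁻ ω, EReal.exp ((l : EReal) * PhiSub.supAbs X ω) ∂P ≤
        ENNReal.ofReal (2 * (Real.exp (φ (l * PhiSub.epsZero φ P X / (1 - θ))) *
          PhiSub.rInv r ((PhiSub.entropyIntegral r (PhiSub.rho φ P X)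
            (θ * PhiSub.epsZero φ P X)).toReal / (θ * PhiSub.epsZero φ P X))))) ∧
    (∀ u θ : ℝ, 0 ≤ u → 0 < θ → θ < 1 →
      P {ω | (u : EReal) ≤ PhiSub.supAbs X ω} ≤
        ENNReal.ofReal (2 *
          (Real.exp (-PhiSub.youngFenchel φ (u * (1 - θ) / PhiSub.epsZero φ P X)) *
            PhiSub.rInv r ((PhiSub.entropyIntegral r (PhiSub.rho φ P X)
              (θ * PhiSub.epsZero φ P X)).toReal / (θ * PhiSub.epsZero φ P X))))) := by
  obtain ⟨s, hs⟩ := hsep.exists_seq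
  have hmeas : AEMeasurable (PhiSub.supAbs X) P :=
    (AEMeasurable.iSup fun n => (hX (s n)).aemeasurable.abs.coe_real_ereal).congr
      (hs.mono fun ω hω => hω.symm)
  have hexp : ∀ l θ : ℝ, 0 < l → 0 < θ → θ < 1 →
      ∫⁻ ω, EReal.exp ((l : EReal) * PhiSub.supAbs X ω) ∂P ≤
        ENNReal.ofReal (2 * (Real.exp (φ (l * PhiSub.epsZero φ P X / (1 - θ))) *
          PhiSub.rInv r ((PhiSub.entropyIntegral r (PhiSub.rho φ P X)
            (θ * PhiSub.epsZero φ P X)).toReal / (θ * PhiSub.epsZero φ P X)))) :=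
    fun l θ hl hθ0 hθ1 => PhiSub.lintegral_exp_supAbs_le (fun t => (hX t).aemeasurable) hs hl
      fun F hF => PhiSub.lintegral_iSup_finset_exp_le hφ hX hbdd hpos hr_nonneg hr_mono hr_convex
        hI hl hθ0 hθ1 hF
  refine ⟨hmeas, hexp, fun u θ hu hθ0 hθ1 => ?_⟩
  have hθ : 0 < 1 - θ := sub_pos.2 hθ1
  have hv : 0 < θ * PhiSub.epsZero φ P X := mul_pos hθ0 hpos
  have hR := PhiSub.one_le_rInv hr_mono hr_convex
    (PhiSub.le_entropyMean hr_mono hv (hI _ hv))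
  have hexp' := fun l hl => hexp l θ hl hθ0 hθ1
  set R := PhiSub.rInv r ((PhiSub.entropyIntegral r (PhiSub.rho φ P X)
    (θ * PhiSub.epsZero φ P X)).toReal / (θ * PhiSub.epsZero φ P X))
  have hR0 : 0 ≤ R := zero_le_one.trans hR
  set ε := PhiSub.epsZero φ P X
  rw [← ENNReal.ofReal_toReal (measure_ne_top P _), mul_comm (Real.exp _), ← mul_assoc]
  refine ENNReal.ofReal_le_ofReal (PhiSub.le_mul_exp_neg_youngFenchel hφ (by positivity)
    (by positivity) ?_ fun y hy => ?_)
  -- The trivial bound `p ≤ 2 R` holds because `R ≥ 1`.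
  · have : P.real {ω | (u : EReal) ≤ PhiSub.supAbs X ω} ≤ 1 := measureReal_le_one
    exact this.trans (by linarith)
  -- The choice `λ = y (1 - θ) / ε` turns the argument of `φ` into `y` and `λ u` into `x y` with `x
  -- = u (1 - θ) / ε`.
  · have hl : 0 < y * (1 - θ) / ε := by positivity
    have h := (PhiSub.exp_mul_measure_le_lintegral hmeas hl.le u).trans (hexp' _ hl)
    rw [← ENNReal.ofReal_toReal (measure_ne_top P _),
      ← ENNReal.ofReal_mul (Real.exp_pos _).le,
      ENNReal.ofReal_le_ofReal_iff (by positivity),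
      show y * (1 - θ) / ε * ε / (1 - θ) = y by field_simp,
      show y * (1 - θ) / ε * u = u * (1 - θ) / ε * y by ring] at h
    exact h.trans_eq (by ring)
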